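/- Consider $n \ge 1$ processes $p_0,\dots,p_{n-1}$ on an oriented ring (at $p_j$, port $0$ leads to $p_{j+1}$ and port $1$ to $p_{j-1}$, indices modulo $n$) that is anonymous (no identifiers, all processes run the same algorithm from the same state), asynchronous (every message has a finite but unbounded delay, chosen by an adversary; no message is lost or created) and content-oblivious (messages carry no content, only their arrival on a port is observed). Every process knows a number $U \ge n$, and has private, independent fair coins. An execution solves (quiescently terminating) leader election if every process eventually enters a final state, Leader or Non-Leader, exactly one process enters the state Leader, and when all processes are in their final states no message is in transit. For every constant $c > 0$ there is a randomized algorithm (depending on $c$ and $U$ but not on $n$) with the following properties for all $1 \le n \le U$: 1. its message complexity is $O(n \cdot \log^2 U)$: there is a constant $K$, depending only on $c$, such that in every execution at most $K \cdot n \cdot \log^2 U$ messages are sent in total; 2. it succeeds with probability at least $1 - U^{-c}$: with at least this probability, the coin tosses are such that leader election is solved for every behaviour of the adversary. -/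

import Mathlib

/-! Anonymous asynchronous content-oblivious oriented rings and randomized algorithms on them. -/

namespace ContentOblivious

/-- The two communication ports of a process. -/
abbrev Port := Fin 2

/-- The two final verdicts of a process. -/
inductive Verdict where
  | leader
  | nonLeader

/-- A randomized content-oblivious algorithm, run by every process of an anonymous ring.
A process first tosses `coins` private fair coins and then acts as a state machine. A message has
no content, so a local action is described by how many messages it sends on each port. -/
structure Algorithm where
  /-- number of private fair coins tossed by each process -/
  coins : ℕ
  /-- local states -/
  State : Type
  /-- the state reached, and the number of messages sent on each port, by the local computation
  that precedes the first reception; there is no identifier, so only the coins are an input -/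
  start : (Fin coins → Bool) → State × (Port → ℕ)
  /-- `none` as long as the process is running; a state with a verdict is final -/
  verdict : State → Option Verdict
  /-- the ports on which a running process is waiting for a message -/
  listens : State → Port → Prop
  /-- the effect of receiving a message on a port: the new state, and the number of messages
  sent on each port -/
  receive : State → Port → State × (Port → ℕ)

/-- In the oriented ring on `n` processes, port `0` of process `j` leads to `j + 1` and port `1`
leads to `j - 1`, modulo `n`. -/
def neighbor {n : ℕ} [NeZero n] (j : Fin n) (q : Port) : Fin n :=
  if q = 0 then j + 1 else j - 1

/-- A link joins port `q` of a process to port `opposite q` of its neighbor. -/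
def opposite (q : Port) : Port := 1 - q

/-- A global configuration of the ring. -/
@[ext]
structure Config (A : Algorithm) (n : ℕ) where
  /-- the local state of each process -/
  state : Fin n → A.State
  /-- `transit j q` is the number of messages that were sent towards port `q` of process `j` and
  have not yet been received (they are still travelling, or wait in the local buffer) -/
  transit : Fin n → Port → ℕ
  /-- `sent j q` is the number of messages that process `j` has sent so far on port `q` -/
  sent : Fin n → Port → ℕ

namespace Config

variable {A : Algorithm} {n : ℕ}

/-- The configuration after the initial local computations, when process `j` has tossed `ω j`. -/
def initial [NeZero n] (ω : Fin n → Fin A.coins → Bool) : Config A n where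
  state j := (A.start (ω j)).1
  transit j q := (A.start (ω (neighbor j q))).2 (opposite q)
  sent j q := (A.start (ω j)).2 q

/-- Process `j` can receive a message on port `q`: it is still running, is waiting for a message
on this port, and there is one. -/
def Enabled (C : Config A n) (j : Fin n) (q : Port) : Prop :=
  A.verdict (C.state j) = none ∧ A.listens (C.state j) q ∧ 0 < C.transit j q

/-- Process `j` receives a message on port `q`, changes its state, and sends messages. -/
def deliver [NeZero n] (C : Config A n) (j : Fin n) (q : Port) : Config A n where
  state := Function.update C.state j (A.receive (C.state j) q).1
  transit i r :=
    (if i = j ∧ r = q then C.transit i r - 1 else C.transit i r) +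
      (if neighbor i r = j then (A.receive (C.state j) q).2 (opposite r) else 0)
  sent i r := C.sent i r + (if i = j then (A.receive (C.state j) q).2 r else 0)

/-- The total number of messages sent so far, by all processes on both ports. -/
def messages (C : Config A n) : ℕ := ∑ j, ∑ q, C.sent j q

/-- All processes are in a final state, exactly one of them as the leader, and no message is in
transit. -/
def Elected (C : Config A n) : Prop :=
  (∃ l, ∀ j, A.verdict (C.state j) = some (if j = l then Verdict.leader else Verdict.nonLeader)) ∧
    ∀ j q, C.transit j q = 0

end Config

/-- A schedule of the asynchronous adversary: at each time it may pick a process and a port on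
which this process is to receive a message. -/
abbrev Schedule (n : ℕ) := ℕ → Option (Fin n × Port)

open Classical in
/-- The execution determined by the coin tosses and a schedule. A choice of the adversary that is
not enabled has no effect. -/
noncomputable def run {A : Algorithm} {n : ℕ} [NeZero n] (ω : Fin n → Fin A.coins → Bool)
    (σ : Schedule n) : ℕ → Config A n
  | 0 => Config.initial ω
  | t + 1 =>
    match σ t with
    | none => run ω σ t
    | some (j, q) =>
      if (run ω σ t).Enabled j q then (run ω σ t).deliver j q else run ω σ t

/-- All delays are finite: it does not happen that a process can from some time on permanently
receive a message on a port, but never does so again. -/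
def Fair {A : Algorithm} {n : ℕ} [NeZero n] (ω : Fin n → Fin A.coins → Bool)
    (σ : Schedule n) : Prop :=
  ∀ j q t, (∀ t' ≥ t, (run ω σ t').Enabled j q) → ∃ t' ≥ t, σ t' = some (j, q)

/-- With the coin tosses `ω`, the algorithm solves quiescently terminating leader election,
whatever the delays are. -/
def Succeeds (A : Algorithm) {n : ℕ} [NeZero n] (ω : Fin n → Fin A.coins → Bool) : Prop :=
  ∀ σ : Schedule n, Fair ω σ → ∃ t, (run ω σ t).Elected

/-- The probability that `A` succeeds on the ring on `n` processes, all coins being independent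
and fair. -/
noncomputable def successProbability (A : Algorithm) (n : ℕ) [NeZero n] : ℝ :=
  (PMF.uniformOfFintype (Fin n → Fin A.coins → Bool)).toMeasure.real {ω | Succeeds A ω}

end ContentOblivious

/-! ### The sieve algorithm: local states and message counters -/

namespace ContentOblivious

/-! Candidates are sieved in `T` phases, with one coin per phase: if some candidate has bit 1, those
with bit 0 drop out; otherwise all stay. In each phase every process receives and sends exactly one
clockwise and `k` counterclockwise messages. This bounds the total for all coin tosses and leaves
nothing in transit after phase `T`.

A candidate with bit 0 learns whether a 1 exists from the order of arrivals. A candidate with bit 1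
sends its clockwise message at once, but dams the counterclockwise flow until a clockwise message
reaches it. A candidate with bit 0 stays one counterclockwise message ahead of what it received, and
sends its clockwise message only after receiving one or after all `k` counterclockwise ones. All
other processes relay. If a 1 exists, a 0-candidate not yet reached by a clockwise message can get
only as many counterclockwise messages as there are 0-candidates strictly between it and the next
dam. This is less than `k - 1` when runs of 0-candidates are shorter than `k`, so the clockwise
message comes early and defeats it (`ccw_add_lt`). If no 1 exists, clockwise messages trail the
complete counterclockwise flow (`no_early_cw`). To keep them behind, a 0-candidate with `k - 1`
counterclockwise receptions does not accept a clockwise message: forwarding it then could defeat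
someone wrongly.

The invariants are `Ledger` (message accounting) and `Conforms` (each phase has the intended
outcome). Receptions are bounded in number, so a fair run gets stuck, and a stuck configuration has
completed all phases (`phase_le_of_stuck`).

Bad coins require two processes with identical tosses, or an arc with at least `k` candidates, all
with bit 0. For `k = 2 * T` a union bound gives at most `2 * n ^ 2 / 2 ^ T`, and `T` about `(c + 2)
* logb 2 U` suffices. -/

/-- The bit tossed for phase `t`. -/
def tossed {T : ℕ} (x : Fin T → Bool) (t : ℕ) : Bool := if h : t < T then x ⟨t, h⟩ else false

/-- The local state of a process in the sieve algorithm. The fields `cw` and `ccw` count the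
clockwise and counterclockwise messages received in the current phase. -/
structure SieveState (T : ℕ) where
  coin : Fin T → Bool
  phase : ℕ
  cw : ℕ
  ccw : ℕ
  candidate : Bool
  defeated : Bool

namespace SieveState

variable {T k : ℕ}

/-- The bit used in the current phase. -/
def bit (s : SieveState T) : Bool := tossed s.coin s.phase

/-- A phase ends after one clockwise and `k` counterclockwise receptions; undefeated candidates
remain candidates. -/
def advance (k : ℕ) (s : SieveState T) : SieveState T :=
  if s.cw = 1 ∧ s.ccw = k then
    ⟨s.coin, s.phase + 1, 0, 0, s.candidate && !s.defeated, false⟩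
  else s

/-- The effect of a reception. A candidate with bit `0` is defeated by a clockwise message that
arrives before `k - 1` counterclockwise ones. -/
def step (k : ℕ) (s : SieveState T) (q : Port) : SieveState T :=
  if q = 0 then advance k { s with ccw := s.ccw + 1 }
  else advance k
    { s with
      cw := 1
      defeated := s.defeated || (s.candidate && !s.bit && decide (s.ccw + 1 < k)) }

/-- Number of messages received so far on each port. -/
def received (k : ℕ) (s : SieveState T) (q : Port) : ℕ :=
  if q = 0 then s.phase * k + s.ccw else s.phase + s.cw

/-- Number of clockwise messages sent in the current phase. -/
def cwSent (k : ℕ) (s : SieveState T) : ℕ :=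
  if s.phase < T then
    if s.candidate then if s.bit ∨ s.cw = 1 ∨ s.ccw = k then 1 else 0 else s.cw
  else 0

/-- Number of counterclockwise messages sent in the current phase. -/
def ccwSent (k : ℕ) (s : SieveState T) : ℕ :=
  if s.phase < T then
    if s.candidate then if s.bit ∧ s.cw = 0 then 0 else min k (s.ccw + 1) else s.ccw
  else 0

/-- Number of messages sent so far on each port. -/
def emitted (k : ℕ) (s : SieveState T) (q : Port) : ℕ :=
  if q = 0 then s.phase + s.cwSent k else s.phase * k + s.ccwSent k

/-- The ports on which a process waits for a message. -/
def Listens (k : ℕ) (s : SieveState T) (q : Port) : Prop :=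
  if q = 0 then s.ccw < k
  else s.cw = 0 ∧ (s.candidate = true → s.bit = false → s.ccw + 1 ≠ k)

/-- The initial state. -/
def init (x : Fin T → Bool) : SieveState T := ⟨x, 0, 0, 0, true, false⟩

/-- The range of the counters. -/
structure Valid (k : ℕ) (s : SieveState T) : Prop where
  phase_le : s.phase ≤ T
  cw_le : s.cw ≤ 1
  ccw_le : s.ccw ≤ k
  incomplete : ¬(s.cw = 1 ∧ s.ccw = k)
  done : s.phase = T → s.cw = 0 ∧ s.ccw = 0

theorem valid_init (x : Fin T → Bool) : (init x).Valid k := by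
  constructor <;> simp [init]

theorem received_init (x : Fin T → Bool) (q : Port) : (init x).received k q = 0 := by
  simp [received, init]

theorem coin_step (s : SieveState T) (q : Port) : (s.step k q).coin = s.coin := by
  unfold step advance
  split_ifs <;> rfl

theorem Valid.step {s : SieveState T} (hs : s.Valid k) (hT : s.phase < T) {q : Port}
    (hq : s.Listens k q) : (s.step k q).Valid k := by
  obtain ⟨h1, h2, h3, h4, h5⟩ := hs
  unfold Listens at hq
  unfold SieveState.step advance
  split_ifs at hq ⊢ <;> constructor <;> simp_all <;> omega

theorem received_step {s : SieveState T} (hs : s.Valid k) {q : Port}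
    (hq : s.Listens k q) (r : Port) :
    (s.step k q).received k r = s.received k r + if r = q then 1 else 0 := by
  obtain ⟨h1, h2, h3, h4, h5⟩ := hs
  have key : (s.phase + 1) * k = s.phase * k + k := by ring
  unfold Listens at hq
  unfold SieveState.step advance received
  fin_cases q <;> fin_cases r <;> simp at hq ⊢ <;> split_ifs <;> simp_all <;> omega

theorem cwSent_le {s : SieveState T} (hs : s.Valid k) : s.cwSent k ≤ 1 := by
  have := hs.cw_le
  unfold cwSent
  split_ifs <;> omega

theorem ccwSent_le {s : SieveState T} (hs : s.Valid k) : s.ccwSent k ≤ k := by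
  have := hs.ccw_le
  unfold ccwSent
  split_ifs <;> omega

/-- Emission counters never decrease, even across a phase change, because a phase emits at most 1
and `k` messages. Hence the truncated subtraction in the `receive` field of `sieve` is exact. -/
theorem emitted_le_advance {s t : SieveState T} (hs : s.Valid k) (hc : t.coin = s.coin)
    (hp : t.phase = s.phase) (hca : t.candidate = s.candidate) (h1 : s.cw ≤ t.cw)
    (h2 : s.ccw ≤ t.ccw) (h3 : t.ccw ≤ k) (h5 : t.cw ≤ 1) (r : Port) :
    s.emitted k r ≤ (t.advance k).emitted k r := by
  have hcw := cwSent_le hs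
  have hccw := ccwSent_le hs
  have h4 := hs.ccw_le
  have key : (s.phase + 1) * k = s.phase * k + k := by ring
  have hb : t.bit = s.bit := by unfold bit; rw [hc, hp]
  unfold advance
  split_ifs with h
  · simp only [emitted, hp]
    split_ifs <;> omega
  · have e1 : s.cwSent k ≤ t.cwSent k := by
      unfold cwSent
      rw [hp, hca, hb]
      clear key
      split_ifs <;> grind
    have e2 : s.ccwSent k ≤ t.ccwSent k := by
      unfold ccwSent
      rw [hp, hca, hb]
      split_ifs <;> grind
    simp only [emitted, hp]
    split_ifs <;> omega

theorem emitted_le_step {s : SieveState T} (hs : s.Valid k) {q : Port}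
    (hq : s.Listens k q) (r : Port) : s.emitted k r ≤ (s.step k q).emitted k r := by
  unfold Listens at hq
  have := hs.ccw_le
  unfold SieveState.step
  split_ifs at hq ⊢
  · exact emitted_le_advance (t := { s with ccw := s.ccw + 1 }) hs rfl rfl rfl le_rfl
      (Nat.le_succ _) hq hs.cw_le r
  · refine emitted_le_advance (t := SieveState.mk s.coin s.phase 1 s.ccw s.candidate _) hs rfl rfl rfl hs.cw_le le_rfl
      this le_rfl r

theorem emitted_le {s : SieveState T} (hs : s.Valid k) (q : Port) :
    s.emitted k q ≤ if q = 0 then T else T * k := by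
  have hc := cwSent_le hs
  have hcc := ccwSent_le hs
  unfold emitted
  rcases hs.phase_le.lt_or_eq with h | h
  · have : (s.phase + 1) * k ≤ T * k := Nat.mul_le_mul_right _ h
    have key : (s.phase + 1) * k = s.phase * k + k := by ring
    split_ifs <;> omega
  · simp [cwSent, ccwSent, h]

theorem received_le {s : SieveState T} (hs : s.Valid k) (q : Port) :
    s.received k q ≤ (T + 1) * (k + 1) := by
  have : s.phase * k ≤ T * k := Nat.mul_le_mul_right _ hs.phase_le
  have h1 := hs.phase_le
  have h2 := hs.cw_le
  have h3 := hs.ccw_le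
  have key : (T + 1) * (k + 1) = T * k + T + k + 1 := by ring
  unfold received
  split_ifs <;> omega

end SieveState

open SieveState

/-- The sieve algorithm with `T` phases and `k` counterclockwise messages per phase. -/
def sieve (T k : ℕ) : Algorithm where
  coins := T
  State := SieveState T
  start x := (init x, (init x).emitted k)
  verdict s := if s.phase < T then none
    else some (if s.candidate then Verdict.leader else Verdict.nonLeader)
  listens := Listens k
  receive s q := (s.step k q, fun r => (s.step k q).emitted k r - s.emitted k r)

/-- The local state of a process of the sieve algorithm. -/
def Config.local {T k n : ℕ} (C : Config (sieve T k) n) (j : Fin n) : SieveState T := C.state j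

theorem enabled_iff {T k n : ℕ} {C : Config (sieve T k) n} {j : Fin n} {q : Port} :
    C.Enabled j q ↔ (C.local j).phase < T ∧ (C.local j).Listens k q ∧ 0 < C.transit j q := by
  unfold Config.Enabled
  simp only [sieve, Config.local]
  split_ifs with h <;> simp [h]

/-! ### Message accounting and termination of runs -/

/-- The counters of the processes account for all messages. -/
structure Ledger {T k n : ℕ} [NeZero n] (ω : Fin n → Fin T → Bool) (C : Config (sieve T k) n) :
    Prop where
  coin : ∀ j, (C.local j).coin = ω j
  valid : ∀ j, (C.local j).Valid k
  sent : ∀ j q, C.sent j q = (C.local j).emitted k q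
  transit : ∀ j q, C.transit j q + (C.local j).received k q =
    (C.local (neighbor j q)).emitted k (opposite q)

section Runs

variable {T k n : ℕ} [NeZero n] {ω : Fin n → Fin T → Bool}

theorem local_deliver (C : Config (sieve T k) n) (j : Fin n) (q : Port) (i : Fin n) :
    (C.deliver j q).local i = if i = j then (C.local j).step k q else C.local i := by
  unfold Config.local Config.deliver
  by_cases h : i = j
  · subst h; simp [sieve]
  · simp only [Function.update_of_ne h]
    exact (if_neg h).symm

theorem ledger_initial : Ledger (k := k) ω (Config.initial (A := sieve T k) ω) where
  coin j := rfl
  valid j := valid_init _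
  sent j q := rfl
  transit j q := by
    have : ((Config.initial (A := sieve T k) ω).local j).received k q = 0 := received_init _ q
    rw [this]; rfl

theorem Ledger.deliver {C : Config (sieve T k) n} (h : Ledger ω C) {j : Fin n} {q : Port}
    (he : C.Enabled j q) : Ledger ω (C.deliver j q) := by
  rw [enabled_iff] at he
  obtain ⟨h1, h2, h3⟩ := he
  have hm := emitted_le_step (h.valid j) h2
  have hr := received_step (h.valid j) h2
  refine ⟨fun i => ?_, fun i => ?_, fun i r => ?_, fun i r => ?_⟩
  · rw [local_deliver]
    split_ifs with hi
    · rw [coin_step, hi, h.coin]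
    · exact h.coin i
  · rw [local_deliver]
    split_ifs with hi
    · exact (h.valid j).step h1 h2
    · exact h.valid i
  · rw [local_deliver]
    have h0 := h.sent i r
    simp only [Config.deliver]
    split_ifs with hi
    · subst hi
      have := hm r
      change C.sent i r + (((C.local i).step k q).emitted k r - (C.local i).emitted k r) = _
      omega
    · simpa using h0
  · have h0 := h.transit i r
    have h4 : (C.deliver j q).transit i r =
        (if i = j ∧ r = q then C.transit i r - 1 else C.transit i r) +
        (if neighbor i r = j then ((C.local j).step k q).emitted k (opposite r) -
          (C.local j).emitted k (opposite r) else 0) := rfl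
    rw [h4, local_deliver, local_deliver]
    have h5 := hm (opposite r)
    have h6 := hr r
    by_cases hi : i = j
    · subst hi
      by_cases hq : r = q
      · subst hq
        by_cases hn : neighbor i r = i
        · simp only [hn, and_self, if_true] at *
          omega
        · simp only [hn, and_self, if_true, if_false] at *
          omega
      · by_cases hn : neighbor i r = i
        · simp only [hn, hq, and_false, if_true, if_false] at *
          omega
        · simp only [hn, hq, and_false, if_true, if_false] at *
          omega
    · by_cases hn : neighbor i r = j
      · simp only [hn, hi, false_and, if_true, if_false] at *
        omega
      · simp only [hn, hi, false_and, if_false] at *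
        omega

end Runs

/-- A property of configurations that is preserved by receptions holds throughout a run. -/
theorem run_induction {A : Algorithm} {n : ℕ} [NeZero n] {ω : Fin n → Fin A.coins → Bool}
    {P : Config A n → Prop} (h0 : P (Config.initial ω))
    (h1 : ∀ C j q, P C → C.Enabled j q → P (C.deliver j q)) (σ : Schedule n) (t : ℕ) :
    P (run ω σ t) := by
  induction t with
  | zero => exact h0
  | succ t ih =>
    rw [run]
    split
    · exact ih
    · split_ifs with h
      · exact h1 _ _ _ ih h
      · exact ih

/-- If a bounded quantity grows with every reception, then every fair run reaches a configuration
in which no reception is possible. -/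
theorem exists_stuck {A : Algorithm} {n : ℕ} [NeZero n] {ω : Fin n → Fin A.coins → Bool}
    (μ : Config A n → ℕ) (B : ℕ) (P : Config A n → Prop) (hP : ∀ σ t, P (run ω σ t))
    (hB : ∀ C, P C → μ C ≤ B)
    (hμ : ∀ C j q, P C → C.Enabled j q → μ C < μ (C.deliver j q)) {σ : Schedule n}
    (hσ : Fair ω σ) : ∃ t, ∀ j q, ¬(run ω σ t).Enabled j q := by
  classical
  -- Once `μ` has reached its maximum over the run, no further reception happens and the
  -- configuration is constant; fairness then excludes an enabled reception.
  obtain ⟨m, ⟨t0, rfl⟩, hm⟩ : ∃ m, (∃ t, μ (run ω σ t) = m) ∧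
      ∀ t, μ (run ω σ t) ≤ m := by
    have hb : ∃ m, ∀ t, μ (run ω σ t) ≤ m := ⟨B, fun t => hB _ (hP σ t)⟩
    refine ⟨Nat.find hb, ?_, Nat.find_spec hb⟩
    by_contra hne
    push Not at hne
    have h0 : Nat.find hb ≠ 0 := fun h0 => hne 0 (by have := Nat.find_spec hb 0; omega)
    refine Nat.find_min hb (Nat.sub_lt (Nat.pos_of_ne_zero h0) one_pos) fun t => ?_
    have := Nat.find_spec hb t
    have := hne t
    omega
  have hconst : ∀ t ≥ t0, run ω σ t = run ω σ t0 := by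
    intro t ht
    induction t, ht using Nat.le_induction with
    | base => rfl
    | succ t ht ih =>
      have hle := hm (t + 1)
      rw [run] at hle ⊢
      split
      · exact ih
      · rename_i j q hj
        split_ifs with he
        · rw [hj] at hle
          simp only [he, if_true] at hle
          have := hμ _ _ _ (hP σ t) he
          rw [ih] at this hle
          omega
        · exact ih
  refine ⟨t0, fun j q he => ?_⟩
  obtain ⟨t, ht, hs⟩ := hσ j q t0 fun t' ht' => by rw [hconst t' ht']; exact he
  have h1 := hm (t + 1)
  rw [run, hs, hconst t ht] at h1
  simp only [he, if_true] at h1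
  have := hμ _ _ _ (hP σ t0) he
  omega

section Runs

variable {T k n : ℕ} [NeZero n] {ω : Fin n → Fin T → Bool}

theorem ledger_run (σ : Schedule n) (t : ℕ) : Ledger ω (run (A := sieve T k) ω σ t) :=
  run_induction (A := sieve T k) (ω := ω) ledger_initial (fun _ _ _ h he => h.deliver he) σ t

theorem messages_run_le (σ : Schedule n) (t : ℕ) :
    (run (A := sieve T k) ω σ t).messages ≤ n * (T * (k + 1)) := by
  have h := ledger_run (k := k) (ω := ω) σ t
  unfold Config.messages
  calc _ ≤ ∑ _j : Fin n, T * (k + 1) := Finset.sum_le_sum fun j _ => ?_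
    _ = _ := by simp
  rw [Fin.sum_univ_two, h.sent, h.sent]
  have h0 := emitted_le (h.valid j) 0
  have h1 := emitted_le (h.valid j) 1
  simp only [if_true, one_ne_zero, if_false] at h0 h1
  have : T * (k + 1) = T * k + T := by ring
  omega

theorem exists_stuck_sieve {σ : Schedule n} (hσ : Fair (A := sieve T k) ω σ) :
    ∃ t, ∀ j q, ¬(run (A := sieve T k) ω σ t).Enabled j q := by
  refine exists_stuck (A := sieve T k) (ω := ω)
    (fun C => ∑ j, ∑ q, (C.local j).received k q) (n * (2 * ((T + 1) * (k + 1)))) (Ledger ω)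
    ledger_run (fun C hC => ?_) (fun C j q hC he => ?_) hσ
  · calc _ ≤ ∑ _j : Fin n, ∑ _q : Port, (T + 1) * (k + 1) :=
          Finset.sum_le_sum fun j _ => Finset.sum_le_sum fun q _ => received_le (hC.valid j) q
      _ = _ := by simp
  · have hr := received_step (hC.valid j) (enabled_iff.1 he).2.1
    have hle : ∀ i r, (C.local i).received k r ≤ ((C.deliver j q).local i).received k r := by
      intro i r
      rw [local_deliver]
      split_ifs with hi
      · rw [hr r, hi]; omega
      · rfl
    refine Finset.sum_lt_sum (fun i _ => Finset.sum_le_sum fun r _ => hle i r)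
      ⟨j, Finset.mem_univ j, Finset.sum_lt_sum (fun r _ => hle j r) ⟨q, Finset.mem_univ q, ?_⟩⟩
    rw [local_deliver, if_pos rfl, hr q, if_pos rfl]
    omega

end Runs

end ContentOblivious

/-! ### Candidate sets and induction around the ring -/

namespace ContentOblivious

/-- The processes that are still candidates at the beginning of phase `t`. -/
def survivors {T n : ℕ} (ω : Fin n → Fin T → Bool) : ℕ → Finset (Fin n)
  | 0 => Finset.univ
  | t + 1 =>
    if ∃ i ∈ survivors ω t, tossed (ω i) t = true then
      (survivors ω t).filter fun i => tossed (ω i) t = true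
    else survivors ω t

/-- Some candidate has bit `1` in phase `t`. -/
def HasOne {T n : ℕ} (ω : Fin n → Fin T → Bool) (t : ℕ) : Prop :=
  ∃ i ∈ survivors ω t, tossed (ω i) t = true

/-- The `m` consecutive processes starting with `i`. -/
def arc {n : ℕ} [NeZero n] (i : Fin n) : ℕ → Finset (Fin n)
  | 0 => ∅
  | m + 1 => insert i (arc (i + 1) m)

/-- Coin tosses that lead to a unique survivor, and for which no `k` consecutive candidates all
have bit `0` in a phase in which some candidate has bit `1`. -/
structure Favourable {T n : ℕ} [NeZero n] (k : ℕ) (ω : Fin n → Fin T → Bool) : Prop where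
  unique : ∃ l, survivors ω T = {l}
  gap : ∀ t < T, HasOne ω t → ∀ i, ∀ m < n,
    (∀ j ∈ survivors ω t ∩ arc i m, tossed (ω j) t = false) → (survivors ω t ∩ arc i m).card < k

section Ring

variable {n : ℕ} [NeZero n]

theorem val_nsmul_one (x : ℕ) : (x • (1 : Fin n)).val = x % n := by
  induction x with
  | zero => simp
  | succ x ih => rw [succ_nsmul, Fin.val_add, ih, Fin.val_one', ← Nat.add_mod]

theorem exists_eq_add_nsmul (i j : Fin n) : ∃ x < n, j = i + x • (1 : Fin n) := by
  refine ⟨(j - i).val, (j - i).isLt, ?_⟩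
  have : (j - i).val • (1 : Fin n) = j - i := by
    apply Fin.ext
    rw [val_nsmul_one, Nat.mod_eq_of_lt (j - i).isLt]
  rw [this]
  abel

theorem exists_of_mem_arc {i j : Fin n} {m : ℕ} (h : j ∈ arc i m) :
    ∃ x < m, j = i + x • (1 : Fin n) := by
  induction m generalizing i with
  | zero => simp [arc] at h
  | succ m ih =>
    rw [arc, Finset.mem_insert] at h
    rcases h with rfl | h
    · exact ⟨0, by omega, by simp⟩
    · obtain ⟨x, hx, rfl⟩ := ih h
      exact ⟨x + 1, by omega, by rw [succ_nsmul]; abel⟩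

theorem notMem_arc_succ {i : Fin n} {m : ℕ} (hm : m < n) : i ∉ arc (i + 1) m := by
  intro h
  obtain ⟨x, hx, he⟩ := exists_of_mem_arc h
  have h1 : (x + 1) • (1 : Fin n) = 0 := by
    rw [succ_nsmul]
    have : i + (x • (1 : Fin n) + 1) = i + 0 := by
      rw [add_zero]; nth_rewrite 2 [he]; abel
    exact add_left_cancel this
  have h2 := val_nsmul_one (n := n) (x + 1)
  rw [h1, Nat.mod_eq_of_lt (by omega)] at h2
  simp at h2

/-- Induction along the ring in clockwise direction, with the base cases right after the members
of a nonempty set. -/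
theorem ring_induction_cw {S : Finset (Fin n)} (hS : S.Nonempty) {P : Fin n → Prop}
    (h : ∀ j, (j - 1 ∉ S → P (j - 1)) → P j) (j : Fin n) : P j := by
  by_contra hj
  -- A counterexample propagates backwards forever, so it reaches the successor of a member of `S`,
  -- where `P` holds unconditionally.
  have key : ∀ x : ℕ, ¬P (j - x • (1 : Fin n)) := by
    intro x
    induction x with
    | zero => simpa using hj
    | succ x ih =>
      intro hp
      refine ih (h _ fun _ => ?_)
      have : j - x • (1 : Fin n) - 1 = j - (x + 1) • (1 : Fin n) := by rw [succ_nsmul]; abel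
      rwa [this]
  obtain ⟨s, hs⟩ := hS
  obtain ⟨x, -, hx⟩ := exists_eq_add_nsmul (s + 1) j
  refine key x (h _ fun hn => absurd ?_ hn)
  have : j - x • (1 : Fin n) - 1 = s := by rw [hx]; abel
  rwa [this]

/-- Induction along the ring in counterclockwise direction. -/
theorem ring_induction_ccw {S : Finset (Fin n)} (hS : S.Nonempty) {P : Fin n → Prop}
    (h : ∀ j, (j + 1 ∉ S → P (j + 1)) → P j) (j : Fin n) : P j := by
  have hS' : (S.image fun i => -i).Nonempty := hS.image _
  have := ring_induction_cw (P := fun i => P (-i)) hS' (fun i hi => h _ fun hn => ?_) (-j)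
  · simpa using this
  · have e : -(i - 1) = -i + 1 := by abel
    rw [← e]
    refine hi fun hm => hn ?_
    obtain ⟨s, hs, he⟩ := Finset.mem_image.1 hm
    have : -i + 1 = s := by rw [← e, ← he, neg_neg]
    rwa [this]

end Ring

section Survivors

variable {T n : ℕ} {ω : Fin n → Fin T → Bool}

theorem survivors_nonempty [NeZero n] (t : ℕ) : (survivors ω t).Nonempty := by
  induction t with
  | zero => exact ⟨0, Finset.mem_univ _⟩
  | succ t ih =>
    rw [survivors]
    split_ifs with h
    · obtain ⟨i, hi, hb⟩ := h
      exact ⟨i, Finset.mem_filter.2 ⟨hi, hb⟩⟩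
    · exact ih

theorem mem_survivors_succ_of_hasOne {t : ℕ} (h : HasOne ω t) (j : Fin n) :
    j ∈ survivors ω (t + 1) ↔ j ∈ survivors ω t ∧ tossed (ω j) t = true := by
  unfold HasOne at h
  rw [survivors, if_pos h, Finset.mem_filter]

theorem survivors_succ_of_not_hasOne {t : ℕ} (h : ¬HasOne ω t) :
    survivors ω (t + 1) = survivors ω t := by
  unfold HasOne at h
  rw [survivors, if_neg h]

end Survivors

/-! ### The local invariant -/

/-- The local state of process `j` agrees with the intended outcome of its phases. -/
structure Conforms {T n : ℕ} (k : ℕ) (ω : Fin n → Fin T → Bool) (j : Fin n) (s : SieveState T) :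
    Prop where
  coin : s.coin = ω j
  valid : s.Valid k
  candidate : s.candidate = true ↔ j ∈ survivors ω s.phase
  defeated : s.defeated = true ↔ s.cw = 1 ∧ s.candidate = true ∧ s.bit = false
  early : s.candidate = true → s.bit = false → HasOne ω s.phase → s.cw = 0 → s.ccw + 1 < k
  late : s.candidate = true → s.bit = false → ¬HasOne ω s.phase → s.cw = 0

namespace Conforms

open SieveState

variable {T k n : ℕ} {ω : Fin n → Fin T → Bool} {j : Fin n} {s : SieveState T}

theorem bit_eq (h : Conforms k ω j s) : s.bit = tossed (ω j) s.phase := by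
  rw [SieveState.bit, h.coin]

theorem init (hk : 2 ≤ k) : Conforms k ω j (init (ω j)) where
  coin := rfl
  valid := valid_init _
  candidate := by simp [SieveState.init, survivors]
  defeated := by simp [SieveState.init]
  early _ _ _ _ := by simp only [SieveState.init]; omega
  late _ _ _ := rfl

/-- The phase change. -/
theorem next (h : Conforms k ω j s) (hk : 2 ≤ k) {s' : SieveState T} (hv : s'.Valid k)
    {d : Bool} (hd : d = true ↔ (s.candidate = true ∧ s.bit = false ∧ HasOne ω s.phase))
    (hs : s' = ⟨s.coin, s.phase + 1, 0, 0, s.candidate && !d, false⟩) : Conforms k ω j s' := by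
  subst hs
  refine ⟨h.coin, hv, ?_, by simp, fun _ _ _ _ => hk, fun _ _ _ => rfl⟩
  have hc := h.candidate
  have hb := h.bit_eq
  change (s.candidate && !d) = true ↔ j ∈ survivors ω (s.phase + 1)
  rw [← Bool.not_eq_true] at hd
  rw [Bool.and_eq_true, Bool.not_eq_true', ← Bool.not_eq_true, hd]
  by_cases ho : HasOne ω s.phase
  · rw [mem_survivors_succ_of_hasOne ho, ← hc, ← hb]
    tauto
  · rw [survivors_succ_of_not_hasOne ho, ← hc]
    tauto

/-- `h1` and `h2` isolate what depends on the rest of the ring: without a 1 no clockwise message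
comes early, and with a 1 an unreached 0-candidate stays below `k - 1` counterclockwise receptions.
-/
theorem step (h : Conforms k ω j s) (hk : 2 ≤ k) (hT : s.phase < T) {q : Port}
    (hq : s.Listens k q)
    (h1 : q = 1 → s.candidate = true → s.bit = false → ¬HasOne ω s.phase → ¬s.ccw + 1 < k)
    (h2 : q = 0 → s.candidate = true → s.bit = false → HasOne ω s.phase → s.cw = 0 →
      s.ccw + 2 < k) : Conforms k ω j (s.step k q) := by
  have hv := h.valid.step hT hq
  have hone : s.candidate = true → s.bit = true → HasOne ω s.phase := fun hc hb =>
    ⟨j, h.candidate.1 hc, by rw [← h.bit_eq, hb]⟩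
  have hd := h.defeated
  have he := h.early
  have hl := h.late
  by_cases hq0 : q = 0
  · subst hq0
    unfold Listens at hq
    simp only [if_true] at hq
    unfold SieveState.step advance at hv ⊢
    simp only [if_true] at hv ⊢
    split_ifs at hv ⊢ with hc
    · refine h.next hk hv (d := s.defeated) ?_ rfl
      rw [hd]
      have this : s.cw = 1 := hc.1
      constructor
      · rintro ⟨-, hca, hb⟩
        refine ⟨hca, hb, ?_⟩
        by_contra hn
        have := hl hca hb hn
        omega
      · rintro ⟨hca, hb, -⟩
        exact ⟨this, hca, hb⟩
    · exact ⟨h.coin, hv, h.candidate, h.defeated, fun hca hb ho hcw =>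
        h2 rfl hca hb ho hcw, h.late⟩
  · have hq1 : q = 1 := Fin.eq_one_of_ne_zero q hq0
    subst hq1
    unfold Listens at hq
    simp only [one_ne_zero, if_false] at hq
    obtain ⟨hcw, hq⟩ := hq
    have hdf : s.defeated = false := by
      rw [← Bool.not_eq_true, hd, hcw]; simp
    unfold SieveState.step advance at hv ⊢
    simp only [one_ne_zero, if_false] at hv ⊢
    rw [hdf] at hv ⊢
    split_ifs at hv ⊢ with hc
    · refine h.next hk hv ?_ rfl
      have this : s.ccw = k := hc.2
      simp only [Bool.false_or, Bool.and_eq_true, Bool.not_eq_true', decide_eq_true_eq]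
      constructor
      · rintro ⟨_, h⟩
        omega
      · rintro ⟨hca, hb, ho⟩
        exact ⟨⟨hca, hb⟩, he hca hb ho hcw⟩
    · have hne : s.ccw ≠ k := fun h => hc ⟨trivial, h⟩
      have hle := h.valid.ccw_le
      refine ⟨h.coin, hv, h.candidate, ?_, fun _ _ _ h => absurd h one_ne_zero, ?_⟩
      · simp only [Bool.false_or, Bool.and_eq_true, Bool.not_eq_true', decide_eq_true_eq]
        change _ ↔ True ∧ s.candidate = true ∧ s.bit = false
        constructor
        · rintro ⟨h, -⟩
          exact ⟨trivial, h⟩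
        · rintro ⟨-, hca, hb⟩
          refine ⟨⟨hca, hb⟩, ?_⟩
          have := hq hca hb
          omega
      · intro hca hb ho
        have := h1 rfl hca hb ho
        have := hq hca hb
        omega

end Conforms

end ContentOblivious

/-! ### Cumulative counts relative to phase `t` -/

namespace ContentOblivious

namespace SieveState

variable {T k t x : ℕ} {s : SieveState T}

theorem received_zero : s.received k 0 = s.phase * k + s.ccw := rfl

theorem received_one : s.received k 1 = s.phase + s.cw := rfl

theorem emitted_zero : s.emitted k 0 = s.phase + s.cwSent k := rfl

theorem emitted_one : s.emitted k 1 = s.phase * k + s.ccwSent k := rfl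

/-- Processes may be in different phases, so bounds are stated for cumulative counts. A process
before or after phase `t` satisfies them by counting alone; only `s.phase = t` needs the sending
rules. -/
theorem Valid.emitted_zero_le (hv : s.Valid k) (h : s.phase < t) : s.emitted k 0 ≤ t := by
  have := cwSent_le hv
  rw [emitted_zero]
  omega

theorem Valid.emitted_one_le (hv : s.Valid k) (h : s.phase < t) : s.emitted k 1 ≤ t * k := by
  have := ccwSent_le hv
  have h1 : (s.phase + 1) * k ≤ t * k := Nat.mul_le_mul_right k h
  rw [emitted_one]
  linarith

theorem le_received_zero (h : t < s.phase) : t * k + k ≤ s.received k 0 := by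
  have h1 : (t + 1) * k ≤ s.phase * k := Nat.mul_le_mul_right k h
  rw [received_zero]
  linarith

theorem le_emitted_one (h : t < s.phase) : t * k + k ≤ s.emitted k 1 := by
  have h1 : (t + 1) * k ≤ s.phase * k := Nat.mul_le_mul_right k h
  rw [emitted_one]
  linarith

theorem le_received_one (h : t < s.phase) : t + 1 ≤ s.received k 1 := by
  rw [received_one]; omega

theorem le_emitted_zero (h : t < s.phase) : t + 1 ≤ s.emitted k 0 := by
  rw [emitted_zero]; omega

end SieveState

open SieveState

namespace Conforms

variable {T k n t x : ℕ} {ω : Fin n → Fin T → Bool} {j : Fin n} {s : SieveState T}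

/-- Only candidates with bit `1`, or candidates when there is no bit `1`, send a clockwise message
without having received one. -/
theorem emitted_zero_le_of_received (h : Conforms k ω j s) (ht : t < T)
    (hj : j ∈ survivors ω t → HasOne ω t ∧ tossed (ω j) t = false)
    (hr : s.received k 1 ≤ t) : s.emitted k 0 ≤ t := by
  rcases lt_trichotomy s.phase t with hp | hp | hp
  · exact h.valid.emitted_zero_le hp
  · subst hp
    rw [received_one] at hr
    rw [← h.candidate, ← h.bit_eq] at hj
    have he := h.early
    have : s.cwSent k = 0 := by
      unfold cwSent
      split_ifs with h1 h3
      · obtain ⟨ho, hb⟩ := hj h1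
        have := he h1 hb ho (by omega)
        rcases h3 with h3 | h3 | h3
        · rw [hb] at h3; cases h3
        · omega
        · omega
      · rfl
      · omega
    rw [emitted_zero]; omega
  · have := le_received_one (k := k) hp
    omega

theorem emitted_zero_le_of_not_hasOne (h : Conforms k ω j s)
    (hj : j ∈ survivors ω t) (ho : ¬HasOne ω t)
    (hr : s.received k 0 < t * k + k) : s.emitted k 0 ≤ t := by
  rcases lt_trichotomy s.phase t with hp | hp | hp
  · exact h.valid.emitted_zero_le hp
  · subst hp
    rw [received_zero] at hr
    have hb : s.bit = false := by
      rw [h.bit_eq, ← Bool.not_eq_true]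
      exact fun hb => ho ⟨j, hj, hb⟩
    rw [← h.candidate] at hj
    have hl := h.late hj hb ho
    have : s.cwSent k = 0 := by
      unfold cwSent
      simp only [hj, hb, hl]
      simp
      omega
    rw [emitted_zero]; omega
  · have := le_received_zero (k := k) hp
    omega

theorem emitted_one_le_of_notMem (h : Conforms k ω j s) (hj : j ∉ survivors ω t) (hx : x < k)
    (hr : s.received k 0 ≤ t * k + x) : s.emitted k 1 ≤ t * k + x := by
  rcases lt_trichotomy s.phase t with hp | hp | hp
  · exact (h.valid.emitted_one_le hp).trans (Nat.le_add_right _ _)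
  · subst hp
    rw [← h.candidate] at hj
    rw [received_zero] at hr
    have : s.ccwSent k ≤ s.ccw := by
      unfold ccwSent
      simp only [hj]
      split_ifs <;> simp_all
    rw [emitted_one]; omega
  · have := le_received_zero (k := k) hp
    omega

theorem emitted_one_le (h : Conforms k ω j s) (hx : x < k)
    (hr : s.received k 0 ≤ t * k + x) : s.emitted k 1 ≤ t * k + x + 1 := by
  rcases lt_trichotomy s.phase t with hp | hp | hp
  · exact (h.valid.emitted_one_le hp).trans (by omega)
  · subst hp
    rw [received_zero] at hr
    have : s.ccwSent k ≤ s.ccw + 1 := by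
      unfold ccwSent
      split_ifs <;> omega
    rw [emitted_one]; omega
  · have := le_received_zero (k := k) hp
    omega

theorem emitted_one_le_of_one (h : Conforms k ω j s) (hj : j ∈ survivors ω t)
    (hb : tossed (ω j) t = true) (hr : s.received k 1 ≤ t) : s.emitted k 1 ≤ t * k := by
  rcases lt_trichotomy s.phase t with hp | hp | hp
  · exact h.valid.emitted_one_le hp
  · subst hp
    rw [received_one] at hr
    rw [← h.candidate] at hj
    rw [← h.bit_eq] at hb
    have : s.ccwSent k = 0 := by
      unfold ccwSent
      simp [hj, hb]
      omega
    rw [emitted_one]; omega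
  · have := le_received_one (k := k) hp
    omega

theorem le_emitted_zero_of_received (h : Conforms k ω j s) (ht : t < T) (hp : t ≤ s.phase)
    (hr : t + 1 ≤ s.received k 1) : t + 1 ≤ s.emitted k 0 := by
  rcases hp.eq_or_lt with hp | hp
  · subst hp
    rw [received_one] at hr
    have := h.valid.cw_le
    have hcw : s.cw = 1 := by omega
    have : s.cwSent k = 1 := by
      unfold cwSent
      simp [ht, hcw]
    rw [emitted_zero]; omega
  · exact le_emitted_zero hp

theorem le_emitted_zero_of_mem (h : Conforms k ω j s) (ht : t < T) (hp : t ≤ s.phase)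
    (hj : j ∈ survivors ω t) (hr : tossed (ω j) t = true ∨ t * k + k ≤ s.received k 0) :
    t + 1 ≤ s.emitted k 0 := by
  rcases hp.eq_or_lt with hp | hp
  · subst hp
    rw [← h.candidate] at hj
    rw [received_zero, ← h.bit_eq] at hr
    have := h.valid.ccw_le
    have hr' : s.bit = true ∨ s.cw = 1 ∨ s.ccw = k := by
      rcases hr with hr | hr
      · exact Or.inl hr
      · exact Or.inr (Or.inr (by omega))
    have : s.cwSent k = 1 := by
      unfold cwSent
      rw [if_pos ht, if_pos hj, if_pos hr']
    rw [emitted_zero]; omega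
  · exact le_emitted_zero hp

theorem le_emitted_one_of_notMem (h : Conforms k ω j s) (ht : t < T) (hp : t ≤ s.phase)
    (hj : j ∉ survivors ω t) (hx : x ≤ k) (hr : t * k + x ≤ s.received k 0) :
    t * k + x ≤ s.emitted k 1 := by
  rcases hp.eq_or_lt with hp | hp
  · subst hp
    rw [← h.candidate] at hj
    rw [received_zero] at hr
    have : s.ccwSent k = s.ccw := by
      unfold ccwSent
      rw [if_pos ht, if_neg hj]
    rw [emitted_one]; omega
  · have := le_emitted_one (k := k) hp
    omega

theorem le_emitted_one_of_mem (h : Conforms k ω j s) (ht : t < T) (hp : t ≤ s.phase)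
    (hj : j ∈ survivors ω t) (hb : tossed (ω j) t = true → t + 1 ≤ s.received k 1) (hx : x < k)
    (hr : t * k + x ≤ s.received k 0) : t * k + (x + 1) ≤ s.emitted k 1 := by
  rcases hp.eq_or_lt with hp | hp
  · subst hp
    rw [← h.candidate] at hj
    rw [received_zero] at hr
    rw [← h.bit_eq, received_one] at hb
    have hn : ¬(s.bit = true ∧ s.cw = 0) := fun hn => by
      have := hb hn.1
      omega
    have : s.ccwSent k = min k (s.ccw + 1) := by
      unfold ccwSent
      rw [if_pos ht, if_pos hj, if_neg hn]
    rw [emitted_one]; omega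
  · have := le_emitted_one (k := k) hp
    omega

end Conforms

/-! ### Safety: the order of arrivals -/

section Snapshot

variable {T k n : ℕ} [NeZero n] {ω : Fin n → Fin T → Bool} {C : Config (sieve T k) n}

theorem Ledger.received_one_le (h : Ledger ω C) (j : Fin n) :
    C.transit j 1 + (C.local j).received k 1 = (C.local (j - 1)).emitted k 0 := h.transit j 1

theorem Ledger.received_zero_le (h : Ledger ω C) (j : Fin n) :
    C.transit j 0 + (C.local j).received k 0 = (C.local (j + 1)).emitted k 1 := h.transit j 0

/-- In a phase without bit `1`, no process gets a clockwise message before all counterclockwise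
messages have been sent to its left neighbor. -/
theorem no_early_cw (hk : 0 < k) (h : Ledger ω C) (hC : ∀ j, Conforms k ω j (C.local j)) {t : ℕ} (ht : t < T)
    (ho : ¬HasOne ω t) (j : Fin n) (hj : (C.local j).emitted k 1 < t * k + k) :
    (C.local (j - 1)).emitted k 0 ≤ t := by
  revert hj
  refine ring_induction_cw (S := survivors ω t) (survivors_nonempty t)
    (P := fun j => (C.local j).emitted k 1 < t * k + k → (C.local (j - 1)).emitted k 0 ≤ t) ?_ j
  intro j ih hj
  have h1 := h.received_zero_le (j - 1)
  rw [sub_add_cancel] at h1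
  -- A candidate needs all `k` messages from `j` before it sends clockwise. A relay with fewer has
  -- not passed on `k` either, so the induction hypothesis applies to it.
  by_cases hm : j - 1 ∈ survivors ω t
  · exact (hC _).emitted_zero_le_of_not_hasOne hm ho (by omega)
  · have h2 := h.received_one_le (j - 1)
    have h3 : (C.local (j - 1)).emitted k 1 < t * k + k := by
      have := (hC (j - 1)).emitted_one_le_of_notMem (x := k - 1) hm (by omega) (by omega)
      omega
    have h4 := ih hm h3
    exact (hC _).emitted_zero_le_of_received ht (fun hm' => absurd hm' hm) (by omega)

/-- In a phase with a bit `1`, a process that has not yet sent a clockwise message gets at most as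
many counterclockwise messages as there are candidates up to the next one with bit `1`. -/
theorem emitted_one_le_card_arc (h : Ledger ω C) (hC : ∀ j, Conforms k ω j (C.local j)) {t : ℕ}
    (ht : t < T) (ho : HasOne ω t) (m : ℕ) (hm : m < n) (j : Fin n)
    (hz : ∀ i ∈ survivors ω t ∩ arc (j + 1) m, tossed (ω i) t = false)
    (hone : j + 1 + m • (1 : Fin n) ∈ survivors ω t ∧
      tossed (ω (j + 1 + m • (1 : Fin n))) t = true)
    (hk : (survivors ω t ∩ arc (j + 1) m).card < k) (hj : (C.local j).emitted k 0 ≤ t) :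
    (C.local (j + 1)).emitted k 1 ≤ t * k + (survivors ω t ∩ arc (j + 1) m).card := by
  have h1 := h.received_one_le (j + 1)
  rw [add_sub_cancel_right] at h1
  -- `m` is the distance from `j + 1` to a dam. At the dam nothing flows; each 0-candidate before it
  -- adds one message and each relay adds none.
  induction m generalizing j with
  | zero =>
    rw [zero_smul, add_zero] at hone
    exact ((hC _).emitted_one_le_of_one hone.1 hone.2 (by omega)).trans (Nat.le_add_right _ _)
  | succ m ih =>
    have hnot : j + 1 ∉ arc (j + 1 + 1) m := notMem_arc_succ (by omega)
    have hsub : survivors ω t ∩ arc (j + 1 + 1) m ⊆ survivors ω t ∩ arc (j + 1) (m + 1) :=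
      Finset.inter_subset_inter_left (Finset.subset_insert _ _)
    have hcard := Finset.card_le_card hsub
    have hem : (C.local (j + 1)).emitted k 0 ≤ t :=
      (hC _).emitted_zero_le_of_received ht (fun hm' => ⟨ho, hz _ (Finset.mem_inter.2
        ⟨hm', Finset.mem_insert_self _ _⟩)⟩) (by omega)
    have h2 := h.received_one_le (j + 1 + 1)
    rw [add_sub_cancel_right] at h2
    have h3 := ih (by omega) (j + 1) (fun i hi => hz i (hsub hi))
      (by
        have : j + 1 + 1 + m • (1 : Fin n) = j + 1 + (m + 1) • (1 : Fin n) := by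
          rw [succ_nsmul]; abel
        rwa [this])
      (by omega) hem h2
    have h4 := h.received_zero_le (j + 1)
    by_cases hmem : j + 1 ∈ survivors ω t
    · have hc : (survivors ω t ∩ arc (j + 1) (m + 1)).card =
          (survivors ω t ∩ arc (j + 1 + 1) m).card + 1 := by
        rw [arc, Finset.inter_insert_of_mem hmem, Finset.card_insert_of_notMem]
        exact fun hi => hnot (Finset.mem_inter.1 hi).2
      rw [hc, ← add_assoc]
      exact (hC _).emitted_one_le (by omega) (by omega)
    · have hc : survivors ω t ∩ arc (j + 1) (m + 1) = survivors ω t ∩ arc (j + 1 + 1) m := by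
        rw [arc, Finset.inter_insert_of_notMem hmem]
      rw [hc] at hk ⊢
      exact (hC _).emitted_one_le_of_notMem hmem hk (by omega)

/-- With favourable coins, a candidate with bit `0` that has not been reached by a clockwise
message is still waiting for at least two counterclockwise messages. -/
theorem ccw_add_lt (hω : Favourable k ω) (h : Ledger ω C)
    (hC : ∀ j, Conforms k ω j (C.local j)) {t : ℕ} (ht : t < T) (ho : HasOne ω t) {j : Fin n}
    (hmem : j ∈ survivors ω t) (hb : tossed (ω j) t = false)
    (hj : (C.local j).emitted k 0 ≤ t) : (C.local (j + 1)).emitted k 1 + 1 < t * k + k := by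
  classical
  have hex : ∃ m : ℕ, j + m • (1 : Fin n) ∈ survivors ω t ∧
      tossed (ω (j + m • (1 : Fin n))) t = true := by
    obtain ⟨i, hi, hb⟩ := ho
    obtain ⟨x, -, rfl⟩ := exists_eq_add_nsmul j i
    exact ⟨x, hi, hb⟩
  have hlt : Nat.find hex < n := by
    obtain ⟨i, hi, hb⟩ := ho
    obtain ⟨x, hx, rfl⟩ := exists_eq_add_nsmul j i
    exact (Nat.find_min' hex ⟨hi, hb⟩).trans_lt hx
  have hspec := Nat.find_spec hex
  have hmin : ∀ m < Nat.find hex, ¬_ := fun m => Nat.find_min hex (m := m)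
  generalize Nat.find hex = m at hlt hspec hmin
  obtain _ | m := m
  · simp [hb] at hspec
  have hz : ∀ i ∈ survivors ω t ∩ arc j (m + 1), tossed (ω i) t = false := by
    intro i hi
    obtain ⟨hi1, hi2⟩ := Finset.mem_inter.1 hi
    obtain ⟨x, hx, rfl⟩ := exists_of_mem_arc hi2
    rw [← Bool.not_eq_true]
    exact fun hb => hmin x hx ⟨hi1, hb⟩
  -- This arc includes `j` itself, so the arc after `j` has one candidate fewer; that is the extra
  -- `+ 1` in the claim.
  have hgap := hω.gap t ht ho j (m + 1) hlt hz
  have hsub : survivors ω t ∩ arc (j + 1) m ⊆ survivors ω t ∩ arc j (m + 1) :=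
    Finset.inter_subset_inter_left (Finset.subset_insert _ _)
  have hc : (survivors ω t ∩ arc j (m + 1)).card =
      (survivors ω t ∩ arc (j + 1) m).card + 1 := by
    rw [arc, Finset.inter_insert_of_mem hmem, Finset.card_insert_of_notMem]
    exact fun hi => notMem_arc_succ (by omega) (Finset.mem_inter.1 hi).2
  have := emitted_one_le_card_arc h hC ht ho m (by omega) j (fun i hi => hz i (hsub hi))
    (by
      have : j + 1 + m • (1 : Fin n) = j + (m + 1) • (1 : Fin n) := by
        rw [succ_nsmul]; abel
      rwa [this]) (by omega) hj
  omega

theorem conforms_deliver (hk : 2 ≤ k) (hω : Favourable k ω) (h : Ledger ω C)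
    (hC : ∀ j, Conforms k ω j (C.local j)) {j : Fin n} {q : Port} (he : C.Enabled j q) :
    ∀ i, Conforms k ω i ((C.deliver j q).local i) := by
  obtain ⟨hT, hq, htr⟩ := enabled_iff.1 he
  intro i
  rw [local_deliver]
  split_ifs with hi
  swap
  · exact hC i
  subst hi
  refine (hC i).step hk hT hq ?_ ?_
  · rintro rfl hca hb ho hccw
    have h1 := h.received_one_le i
    rw [received_one] at h1
    have h2 := no_early_cw (by omega) h hC hT ho i (by
      have : (C.local i).ccwSent k ≤ (C.local i).ccw + 1 := by
        unfold ccwSent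
        split_ifs <;> omega
      rw [emitted_one]
      omega)
    omega
  · rintro rfl hca hb ho hcw
    have h1 := h.received_zero_le i
    rw [received_zero] at h1
    have hmem := (hC i).candidate.1 hca
    have hb' := hb
    rw [(hC i).bit_eq] at hb'
    have h2 := ccw_add_lt hω h hC hT ho hmem hb'
      ((hC i).emitted_zero_le_of_received hT (fun _ => ⟨ho, hb'⟩) (by rw [received_one]; omega))
    omega

end Snapshot

/-! ### Progress: stuck configurations have finished all phases -/

section Stuck

variable {T k n : ℕ} [NeZero n] {ω : Fin n → Fin T → Bool} {C : Config (sieve T k) n}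

/-- When no reception is possible, a process that lacks a counterclockwise message of some phase
has received everything that was sent to it. -/
theorem received_zero_of_stuck (h : Ledger ω C) (hst : ∀ j q, ¬C.Enabled j q)
    {t x : ℕ} (ht : t < T) (hp : ∀ j, t ≤ (C.local j).phase) (hx : x ≤ k) {j : Fin n} (he : t * k + x ≤ (C.local (j + 1)).emitted k 1) :
    t * k + x ≤ (C.local j).received k 0 := by
  have h1 := h.received_zero_le j
  have hs := hst j 0
  rw [enabled_iff] at hs
  rcases (hp j).eq_or_lt with hpj | hpj
  · subst hpj
    rw [received_zero] at *
    by_cases hc : (C.local j).ccw < k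
    · have : ¬0 < C.transit j 0 := fun h0 => hs ⟨by omega, hc, h0⟩
      omega
    · omega
  · have := le_received_zero (k := k) hpj
    omega

/-- `hj` excludes the one state that refuses a needed clockwise message, a 0-candidate with `ccw + 1
= k`: with a 1 this contradicts `early`, and otherwise `ccw` is already `k`. -/
theorem received_one_of_stuck (h : Ledger ω C) (hC : ∀ j, Conforms k ω j (C.local j))
    (hst : ∀ j q, ¬C.Enabled j q) {t : ℕ} (ht : t < T) (hp : ∀ j, t ≤ (C.local j).phase)
    {j : Fin n} (hj : HasOne ω t ∨ t * k + k ≤ (C.local j).received k 0)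
    (he : t + 1 ≤ (C.local (j - 1)).emitted k 0) :
    t + 1 ≤ (C.local j).received k 1 := by
  have h1 := h.received_one_le j
  have hs := hst j 1
  rw [enabled_iff] at hs
  rcases (hp j).eq_or_lt with hpj | hpj
  · subst hpj
    rw [received_one] at *
    by_contra hn
    have hcw : (C.local j).cw = 0 := by omega
    refine hs ⟨ht, ⟨hcw, fun hca hb => ?_⟩, by omega⟩
    rcases hj with hj | hj
    · exact ((hC j).early hca hb hj hcw).ne
    · rw [received_zero] at hj
      omega
  · exact le_received_one hpj

theorem phase_le_of_stuck (h : Ledger ω C) (hC : ∀ j, Conforms k ω j (C.local j))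
    (hst : ∀ j q, ¬C.Enabled j q) {t : ℕ} (ht : t ≤ T) (j : Fin n) : t ≤ (C.local j).phase := by
  induction t generalizing j with
  | zero => exact Nat.zero_le _
  | succ t ih =>
    have hp : ∀ j, t ≤ (C.local j).phase := ih (by omega)
    -- Induction on the index of the message: after `x` receptions everywhere, candidates have sent
    -- message `x + 1`, provided the dams are open, and relays carry it around the ring.
    have hccw : (HasOne ω t → ∀ j, t + 1 ≤ (C.local j).received k 1) → ∀ x ≤ k, ∀ j,
        t * k + x ≤ (C.local j).received k 0 := by
      intro hall x
      induction x with
      | zero =>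
        intro _ j
        have := Nat.mul_le_mul_right k (hp j)
        rw [received_zero]; omega
      | succ x ihx =>
        intro hx
        refine ring_induction_ccw (survivors_nonempty (ω := ω) t) fun j ihj => ?_
        refine received_zero_of_stuck h hst ht hp hx ?_
        by_cases hm : j + 1 ∈ survivors ω t
        · exact (hC _).le_emitted_one_of_mem ht (hp _) hm (fun hb => hall ⟨_, hm, hb⟩ _) hx
            (ihx (by omega) _)
        · exact (hC _).le_emitted_one_of_notMem ht (hp _) hm hx (ihj hm)
    have hboth : ∀ j, t * k + k ≤ (C.local j).received k 0 ∧
        t + 1 ≤ (C.local j).received k 1 := by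
      -- With a 1, the clockwise wave comes first and opens the dams; without one, there are no dams
      -- and the counterclockwise flow must finish first.
      by_cases ho : HasOne ω t
      · have hne : ((survivors ω t).filter fun i => tossed (ω i) t = true).Nonempty := by
          obtain ⟨i, hi, hb⟩ := ho
          exact ⟨i, Finset.mem_filter.2 ⟨hi, hb⟩⟩
        have hcw : ∀ j, t + 1 ≤ (C.local j).received k 1 := by
          refine ring_induction_cw hne fun j ihj => ?_
          refine received_one_of_stuck h hC hst ht hp (Or.inl ho) ?_
          by_cases hm : j - 1 ∈ (survivors ω t).filter fun i => tossed (ω i) t = true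
          · obtain ⟨hm, hb⟩ := Finset.mem_filter.1 hm
            exact (hC _).le_emitted_zero_of_mem ht (hp _) hm (Or.inl hb)
          · exact (hC _).le_emitted_zero_of_received ht (hp _) (ihj hm)
        exact fun j => ⟨hccw (fun _ => hcw) k le_rfl j, hcw j⟩
      · have hccw := hccw (fun h => absurd h ho) k le_rfl
        refine fun j => ⟨hccw j, ?_⟩
        refine ring_induction_cw (survivors_nonempty (ω := ω) t)
          (P := fun j => t + 1 ≤ (C.local j).received k 1) (fun j ihj => ?_) j
        refine received_one_of_stuck h hC hst ht hp (Or.inr (hccw j)) ?_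
        by_cases hm : j - 1 ∈ survivors ω t
        · exact (hC _).le_emitted_zero_of_mem ht (hp _) hm (Or.inr (hccw _))
        · exact (hC _).le_emitted_zero_of_received ht (hp _) (ihj hm)
    rcases (hp j).eq_or_lt with hpj | hpj
    · obtain ⟨h1, h2⟩ := hboth j
      rw [received_zero, ← hpj] at h1
      rw [received_one, ← hpj] at h2
      have hv := (hC j).valid
      have := hv.cw_le
      have := hv.ccw_le
      exact absurd ⟨by omega, by omega⟩ hv.incomplete
    · exact hpj

end Stuck

/-- With favourable coins, the sieve algorithm succeeds. -/
theorem Favourable.succeeds {T k n : ℕ} [NeZero n] {ω : Fin n → Fin T → Bool} (hk : 2 ≤ k)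
    (hω : Favourable k ω) : Succeeds (sieve T k) ω := by
  intro σ hσ
  obtain ⟨t, hst⟩ := exists_stuck_sieve (k := k) hσ
  refine ⟨t, ?_⟩
  have hinv : Ledger ω (run (A := sieve T k) ω σ t) ∧
      ∀ j, Conforms k ω j ((run (A := sieve T k) ω σ t).local j) :=
    run_induction (A := sieve T k) (ω := ω)
      (P := fun C => Ledger ω C ∧ ∀ j, Conforms k ω j (C.local j))
      ⟨ledger_initial, fun j => Conforms.init hk⟩
      (fun C j q hC he => ⟨hC.1.deliver he, conforms_deliver hk hω hC.1 hC.2 he⟩) σ t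
  generalize run (A := sieve T k) ω σ t = C at hst hinv
  obtain ⟨h, hC⟩ := hinv
  have hp : ∀ j, (C.local j).phase = T := fun j =>
    le_antisymm (hC j).valid.phase_le (phase_le_of_stuck h hC hst le_rfl j)
  constructor
  · obtain ⟨l, hl⟩ := hω.unique
    refine ⟨l, fun j => ?_⟩
    have hc := (hC j).candidate
    rw [hp, hl, Finset.mem_singleton] at hc
    change (if (C.local j).phase < T then none
      else some (if (C.local j).candidate then Verdict.leader else Verdict.nonLeader)) = _
    rw [if_neg (by rw [hp]; exact lt_irrefl T)]
    simp only [hc]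
  · intro j q
    have h1 := h.transit j q
    have h2 := (hC j).valid.done (hp j)
    fin_cases q
    · have h1 := h.received_zero_le j
      rw [received_zero, emitted_one, hp, hp, h2.2] at h1
      simp only [ccwSent, hp, lt_irrefl, if_false] at h1
      change C.transit j 0 = 0
      omega
    · have h1 := h.received_one_le j
      rw [received_one, emitted_zero, hp, hp, h2.1] at h1
      simp only [cwSent, hp, lt_irrefl, if_false] at h1
      change C.transit j 1 = 0
      omega

end ContentOblivious

/-! ### Counting unfavourable coin tosses -/

namespace ContentOblivious

section Counting

variable {T n : ℕ}

/-- If `W` does not depend on the bits of phase `t`, then few coin tosses have only bits `0` on `W`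
in phase `t`. -/
theorem card_zero_on_mul_le (t : Fin T) (k : ℕ) (W : (Fin n → Fin T → Bool) → Finset (Fin n))
    (hW : ∀ ω ω', (∀ i s, s ≠ t → ω i s = ω' i s) → W ω = W ω') :
    (Finset.univ.filter fun ω : Fin n → Fin T → Bool =>
      k ≤ (W ω).card ∧ ∀ j ∈ W ω, ω j t = false).card * 2 ^ k ≤
      Fintype.card (Fin n → Fin T → Bool) := by
  set bad := Finset.univ.filter fun ω : Fin n → Fin T → Bool =>
      k ≤ (W ω).card ∧ ∀ j ∈ W ω, ω j t = false with hbad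
  -- Raise the phase-`t` bits on a subset of `W ω`. This leaves `W` unchanged, and bad tosses are 0
  -- on `W`, so both the tosses and the subset can be recovered.
  let f : (Σ _ : Fin n → Fin T → Bool, Finset (Fin n)) → Fin n → Fin T → Bool :=
    fun p i s => if s = t ∧ i ∈ p.2 then true else p.1 i s
  have hf : ∀ p, W (f p) = W p.1 := fun p => hW _ _ fun i s hs => by simp [f, hs]
  calc bad.card * 2 ^ k = ∑ _ω ∈ bad, 2 ^ k := by simp
    _ ≤ ∑ ω ∈ bad, (W ω).powerset.card := Finset.sum_le_sum fun ω hω => by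
        rw [Finset.card_powerset]
        exact Nat.pow_le_pow_right two_pos (Finset.mem_filter.1 hω).2.1
    _ = (bad.sigma fun ω => (W ω).powerset).card := (Finset.card_sigma _ _).symm
    _ ≤ (Finset.univ : Finset (Fin n → Fin T → Bool)).card := by
        refine Finset.card_le_card_of_injOn f (fun _ _ => Finset.mem_coe.2 (Finset.mem_univ _)) ?_
        rintro ⟨ω, A⟩ h ⟨ω', A'⟩ h' he
        simp only [Finset.mem_coe, Finset.mem_sigma, Finset.mem_powerset, hbad,
          Finset.mem_filter, Finset.mem_univ, true_and] at h h'
        obtain ⟨⟨-, hz⟩, hA⟩ := h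
        obtain ⟨⟨-, hz'⟩, hA'⟩ := h'
        have hWW : W ω = W ω' := by rw [← hf ⟨ω, A⟩, he, hf]
        have hval : ∀ i s, (if s = t ∧ i ∈ A then true else ω i s) =
            if s = t ∧ i ∈ A' then true else ω' i s := fun i s => congrFun (congrFun he i) s
        have hωω : ω = ω' := by
          funext i s
          have hv := hval i s
          by_cases hs : s = t
          · subst hs
            by_cases hi : i ∈ W ω
            · rw [hz i hi, hz' i (hWW ▸ hi)]
            · rw [if_neg fun h => hi (hA h.2), if_neg fun h => hi (hWW ▸ hA' h.2)] at hv
              exact hv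
          · simpa [hs] using hv
        have hAA : A = A' := by
          ext i
          have hv := hval i t
          constructor
          · intro hi
            by_contra hn
            rw [if_pos ⟨rfl, hi⟩, if_neg fun h => hn h.2, hz' i (hWW ▸ hA hi)] at hv
            cases hv
          · intro hi
            by_contra hn
            rw [if_neg fun h => hn h.2, if_pos ⟨rfl, hi⟩, hz i (hWW ▸ hA' hi)] at hv
            cases hv
        rw [hωω, hAA]
    _ = _ := Finset.card_univ

/-- Overwriting row `j` arbitrarily loses nothing, since the old row can be read off row `i`. -/
theorem card_eq_row_mul_le {i j : Fin n} (hij : i ≠ j) :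
    (Finset.univ.filter fun ω : Fin n → Fin T → Bool => ω i = ω j).card * 2 ^ T ≤
      Fintype.card (Fin n → Fin T → Bool) := by
  have h2 : 2 ^ T = (Finset.univ : Finset (Fin T → Bool)).card := by simp
  rw [h2, ← Finset.card_product, ← Finset.card_univ]
  refine Finset.card_le_card_of_injOn (fun p => Function.update p.1 j p.2)
    (fun _ _ => Finset.mem_coe.2 (Finset.mem_univ _)) ?_
  rintro ⟨ω, x⟩ h ⟨ω', x'⟩ h' he
  simp only [Finset.mem_coe, Finset.mem_product, Finset.mem_filter, Finset.mem_univ, true_and,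
    and_true] at h h' he
  have hval := fun l => congrFun he l
  have hx : x = x' := by simpa using hval j
  have hω : ω = ω' := by
    have hne : ∀ l, l ≠ j → ω l = ω' l := fun l hl => by simpa [hl] using hval l
    funext l
    by_cases hl : l = j
    · rw [hl, ← h, ← h', hne i hij]
    · exact hne l hl
  rw [hω, hx]

theorem survivors_congr {ω ω' : Fin n → Fin T → Bool} {t : ℕ}
    (h : ∀ i, ∀ s < t, tossed (ω i) s = tossed (ω' i) s) : survivors ω t = survivors ω' t := by
  induction t with
  | zero => rfl
  | succ t ih =>
    rw [survivors, survivors, ih fun i s hs => h i s (by omega)]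
    simp only [fun i => h i t (by omega)]

/-- Each phase keeps candidates with a common bit: all 1 if a 1 occurs, all 0 otherwise. So two
final survivors have identical tosses. -/
theorem tossed_eq_of_survivors {ω : Fin n → Fin T → Bool} {i j : Fin n} {t : ℕ}
    (hi : i ∈ survivors ω t) (hj : j ∈ survivors ω t) :
    ∀ s < t, tossed (ω i) s = tossed (ω j) s := by
  induction t with
  | zero => intro s hs; omega
  | succ t ih =>
    by_cases ho : HasOne ω t
    · rw [mem_survivors_succ_of_hasOne ho] at hi hj
      intro s hs
      rcases Nat.lt_succ_iff_lt_or_eq.1 hs with hs | rfl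
      · exact ih hi.1 hj.1 s hs
      · rw [hi.2, hj.2]
    · rw [survivors_succ_of_not_hasOne ho] at hi hj
      intro s hs
      rcases Nat.lt_succ_iff_lt_or_eq.1 hs with hs | rfl
      · exact ih hi hj s hs
      · have h0 : ∀ l ∈ survivors ω s, tossed (ω l) s = false := fun l hl => by
          rw [← Bool.not_eq_true]
          exact fun hb => ho ⟨l, hl, hb⟩
        rw [h0 i hi, h0 j hj]

variable [NeZero n]

theorem not_favourable {k : ℕ} {ω : Fin n → Fin T → Bool} (h : ¬Favourable k ω) :
    (∃ i j, i ≠ j ∧ ω i = ω j) ∨ ∃ (t : Fin T) (i : Fin n) (m : Fin n),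
      k ≤ (survivors ω t ∩ arc i m).card ∧ ∀ j ∈ survivors ω t ∩ arc i m, ω j t = false := by
  by_contra hn
  push Not at hn
  obtain ⟨h1, h2⟩ := hn
  refine h ⟨?_, fun t ht _ i m hm hz => ?_⟩
  · obtain ⟨l, hl⟩ := survivors_nonempty (ω := ω) T
    refine ⟨l, Finset.eq_singleton_iff_unique_mem.2 ⟨hl, fun i hi => ?_⟩⟩
    by_contra hne
    refine h1 i l hne (funext fun s => ?_)
    have := tossed_eq_of_survivors hi hl s s.isLt
    simpa [tossed] using this
  · by_contra hc
    obtain ⟨j, hj, hb⟩ := h2 ⟨t, ht⟩ i ⟨m, hm⟩ (not_lt.1 hc)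
    have := hz j hj
    simp only [tossed, ht, dif_pos] at this
    exact hb this

-- The `n ^ 2` pairs cost `2 ^ (-T)` each; the `T * n ^ 2` choices of phase and arc cost `2 ^ (-2 *
-- T)` each, and `T ≤ 2 ^ T` absorbs the factor `T`.
open Classical in
theorem card_not_favourable_le :
    ((Finset.univ.filter fun ω : Fin n → Fin T → Bool => ¬Favourable (2 * T) ω).card : ℝ) ≤
      2 * n ^ 2 / 2 ^ T * Fintype.card (Fin n → Fin T → Bool) := by
  set N : ℝ := (Fintype.card (Fin n → Fin T → Bool) : ℝ) with hN
  let P : Fin n × Fin n → Finset (Fin n → Fin T → Bool) := fun p =>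
    if p.1 = p.2 then ∅ else Finset.univ.filter fun ω => ω p.1 = ω p.2
  let Q : Fin T × Fin n × Fin n → Finset (Fin n → Fin T → Bool) := fun p =>
    Finset.univ.filter fun ω => 2 * T ≤ (survivors ω p.1 ∩ arc p.2.1 p.2.2).card ∧
      ∀ j ∈ survivors ω p.1 ∩ arc p.2.1 p.2.2, ω j p.1 = false
  have hP : ∀ p, ((P p).card : ℝ) ≤ N / 2 ^ T := by
    intro p
    rw [le_div_iff₀ (by positivity)]
    simp only [P]
    split_ifs with hp
    · simp [hN]
    · rw [hN]
      exact_mod_cast card_eq_row_mul_le hp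
  have hQ : ∀ p, ((Q p).card : ℝ) ≤ N / 2 ^ (2 * T) := by
    intro p
    rw [le_div_iff₀ (by positivity)]
    have := card_zero_on_mul_le p.1 (2 * T)
      (fun ω : Fin n → Fin T → Bool => survivors ω p.1 ∩ arc p.2.1 p.2.2) fun ω ω' h => by
        rw [survivors_congr fun i s hs => ?_]
        unfold tossed
        split_ifs with hs'
        · exact h i _ fun he => by rw [← he] at hs; simp at hs
        · rfl
    rw [hN]
    exact_mod_cast this
  have hsub : (Finset.univ.filter fun ω : Fin n → Fin T → Bool => ¬Favourable (2 * T) ω) ⊆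
      Finset.univ.biUnion P ∪ Finset.univ.biUnion Q := by
    intro ω hω
    rw [Finset.mem_union, Finset.mem_biUnion, Finset.mem_biUnion]
    rcases not_favourable (Finset.mem_filter.1 hω).2 with ⟨i, j, hij, he⟩ | ⟨t, i, m, h1, h2⟩
    · exact Or.inl ⟨(i, j), Finset.mem_univ _, by simp [P, hij, he]⟩
    · exact Or.inr ⟨(t, i, m), Finset.mem_univ _, Finset.mem_filter.2 ⟨Finset.mem_univ _, h1, h2⟩⟩
  have hcard := (Finset.card_le_card hsub).trans ((Finset.card_union_le _ _).trans
    (Nat.add_le_add Finset.card_biUnion_le Finset.card_biUnion_le))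
  have hcard' : ((Finset.univ.filter fun ω : Fin n → Fin T → Bool =>
      ¬Favourable (2 * T) ω).card : ℝ) ≤ ∑ p, ((P p).card : ℝ) + ∑ p, ((Q p).card : ℝ) := by
    exact_mod_cast hcard
  have hsum1 : ∑ p, ((P p).card : ℝ) ≤ n ^ 2 * (N / 2 ^ T) := by
    refine (Finset.sum_le_sum fun p _ => hP p).trans_eq ?_
    simp [sq]
  have hsum2 : ∑ p, ((Q p).card : ℝ) ≤ T * n ^ 2 * (N / 2 ^ (2 * T)) := by
    refine (Finset.sum_le_sum fun p _ => hQ p).trans_eq ?_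
    simp [sq]
  have hT2 : (T : ℝ) ≤ 2 ^ T := by exact_mod_cast Nat.lt_two_pow_self.le
  have hlast : T * n ^ 2 * (N / 2 ^ (2 * T)) ≤ n ^ 2 * (N / 2 ^ T) := by
    have e : (2 : ℝ) ^ (2 * T) = 2 ^ T * 2 ^ T := by rw [two_mul, pow_add]
    have hN0 : 0 ≤ N := by positivity
    rw [e]
    calc (T : ℝ) * n ^ 2 * (N / (2 ^ T * 2 ^ T))
        ≤ 2 ^ T * n ^ 2 * (N / (2 ^ T * 2 ^ T)) := by gcongr
      _ = n ^ 2 * (N / 2 ^ T) := by field_simp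
  calc _ ≤ _ := hcard'
    _ ≤ n ^ 2 * (N / 2 ^ T) + n ^ 2 * (N / 2 ^ T) := add_le_add hsum1 (hsum2.trans hlast)
    _ = _ := by ring

/-- The sieve algorithm succeeds with high probability. -/
theorem le_successProbability_sieve (hT : 0 < T) :
    1 - 2 * (n : ℝ) ^ 2 / 2 ^ T ≤ successProbability (sieve T (2 * T)) n := by
  classical
  unfold successProbability
  set S := {ω : Fin n → Fin T → Bool | Succeeds (sieve T (2 * T)) ω}
  change _ ≤ (PMF.uniformOfFintype (Fin n → Fin T → Bool)).toMeasure.real S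
  rw [MeasureTheory.measureReal_def, PMF.toMeasure_uniformOfFintype_apply S S.toFinite.measurableSet,
    ENNReal.toReal_div, ENNReal.toReal_natCast, ENNReal.toReal_natCast]
  have hN : (0 : ℝ) < Fintype.card (Fin n → Fin T → Bool) := by exact_mod_cast Fintype.card_pos
  rw [le_div_iff₀ hN]
  have hb := card_not_favourable_le (T := T) (n := n)
  have hsplit := Finset.card_filter_add_card_filter_not (s := Finset.univ)
    fun ω : Fin n → Fin T → Bool => Favourable (2 * T) ω
  have hle : (Finset.univ.filter fun ω : Fin n → Fin T → Bool => Favourable (2 * T) ω).card ≤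
      Fintype.card S := by
    rw [← Set.toFinset_card]
    refine Finset.card_le_card fun ω hω => Set.mem_toFinset.2 ?_
    exact (Finset.mem_filter.1 hω).2.succeeds (by omega)
  rw [Finset.card_univ] at hsplit
  have h1 : (Fintype.card (Fin n → Fin T → Bool) : ℝ) ≤ Fintype.card S +
      (Finset.univ.filter fun ω : Fin n → Fin T → Bool => ¬Favourable (2 * T) ω).card := by
    rw [← hsplit]
    push_cast
    gcongr
  linarith

end Counting

/-! ### Choice of parameters -/

/-- The number of phases. -/
noncomputable def phases (c : ℝ) (U : ℕ) : ℕ :=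
  if U ≤ 1 then 0 else ⌈(c + 2) * Real.logb 2 U⌉₊ + 1

/-- For `U ≤ 1` the logarithm vanishes, which forces zero phases. Otherwise it is at least 1 and
absorbs the rounding and the extra phase. -/
theorem phases_le {c : ℝ} (hc : 0 < c) (U : ℕ) : (phases c U : ℝ) ≤ (c + 4) * Real.logb 2 U := by
  unfold phases
  split_ifs with hU
  · interval_cases U <;> simp
  · have h1 : 1 ≤ Real.logb 2 U := by
      rw [Real.le_logb_iff_rpow_le (by norm_num) (Nat.cast_pos.2 (by omega)), Real.rpow_one]
      exact_mod_cast not_le.1 hU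
    have h2 := Nat.ceil_lt_add_one (a := (c + 2) * Real.logb 2 U) (by positivity)
    push_cast
    nlinarith

/-- In the exponent, `c` pays for the failure probability, 2 for `n ^ 2 ≤ U ^ 2`, and the extra
phase for the factor 2. -/
theorem le_two_pow_phases (c : ℝ) {U : ℕ} (hU : 1 < U) :
    2 * ((U : ℝ) ^ c * U ^ 2) ≤ 2 ^ phases c U := by
  have hU0 : (0 : ℝ) < U := Nat.cast_pos.2 (by omega)
  unfold phases
  rw [if_neg (not_le.2 hU), pow_succ (2 : ℝ), mul_comm _ (2 : ℝ)]
  gcongr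
  calc (U : ℝ) ^ c * U ^ 2 = (U : ℝ) ^ (c + 2) := by
        rw [Real.rpow_add hU0, Real.rpow_two]
    _ = ((2 : ℝ) ^ Real.logb 2 U) ^ (c + 2) := by
        rw [Real.rpow_logb (by norm_num) (by norm_num) hU0]
    _ = (2 : ℝ) ^ ((c + 2) * Real.logb 2 U) := by
        rw [← Real.rpow_mul (by norm_num), mul_comm]
    _ ≤ (2 : ℝ) ^ ((⌈(c + 2) * Real.logb 2 U⌉₊ : ℕ) : ℝ) :=
        Real.rpow_le_rpow_of_exponent_le (by norm_num) (Nat.le_ceil _)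
    _ = _ := Real.rpow_natCast _ _

end ContentOblivious

theorem theorem4 (c : ℝ) (hc : 0 < c) :
    ∃ (A : ℕ → ContentOblivious.Algorithm) (K : ℝ), ∀ (U n : ℕ) [NeZero n], n ≤ U →
      (∀ (ω : Fin n → Fin (A U).coins → Bool) (σ : ContentOblivious.Schedule n) (t : ℕ),
        ((ContentOblivious.run ω σ t).messages : ℝ) ≤ K * (n * Real.logb 2 U ^ 2)) ∧
      1 - (U : ℝ) ^ (-c) ≤ ContentOblivious.successProbability (A U) n := by
  refine ⟨fun U => ContentOblivious.sieve (ContentOblivious.phases c U)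
    (2 * ContentOblivious.phases c U), 3 * (c + 4) ^ 2, fun U n _ hn => ⟨fun ω σ t => ?_, ?_⟩⟩
  · have h1 := ContentOblivious.messages_run_le (T := ContentOblivious.phases c U)
      (k := 2 * ContentOblivious.phases c U) (ω := ω) σ t
    have h2 := ContentOblivious.phases_le hc U
    have h3 (T : ℕ) : T * (2 * T + 1) ≤ 3 * T ^ 2 := by nlinarith [Nat.le_self_pow two_ne_zero T]
    have h4 : (ContentOblivious.phases c U : ℝ) ^ 2 ≤ ((c + 4) * Real.logb 2 U) ^ 2 := by gcongr
    calc ((ContentOblivious.run ω σ t).messages : ℝ)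
        ≤ n * (3 * (ContentOblivious.phases c U : ℝ) ^ 2) := by
          exact_mod_cast h1.trans (Nat.mul_le_mul_left n (h3 _))
      _ ≤ n * (3 * ((c + 4) * Real.logb 2 U) ^ 2) := by gcongr
      _ = _ := by ring
  · have hn0 : 0 < n := Nat.pos_of_neZero n
    -- For `U = 1` the required probability is 0.
    rcases (show 1 ≤ U by omega).eq_or_lt with rfl | hU
    · rw [Nat.cast_one, Real.one_rpow, sub_self]
      exact MeasureTheory.measureReal_nonneg
    · refine le_trans ?_ (ContentOblivious.le_successProbability_sieve ?_)
      · have hU0 : (0 : ℝ) < U := Nat.cast_pos.2 (by omega)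
        have hUc : (0 : ℝ) < (U : ℝ) ^ c := Real.rpow_pos_of_pos hU0 c
        have h1 := ContentOblivious.le_two_pow_phases c hU
        have h2 : (n : ℝ) ^ 2 ≤ (U : ℝ) ^ 2 := by gcongr
        have h3 : 2 * (n : ℝ) ^ 2 / 2 ^ ContentOblivious.phases c U ≤ (U : ℝ) ^ (-c) := by
          rw [Real.rpow_neg hU0.le, div_le_iff₀ (by positivity)]
          calc 2 * (n : ℝ) ^ 2 ≤ 2 * (U : ℝ) ^ 2 := by gcongr
            _ = ((U : ℝ) ^ c)⁻¹ * (2 * ((U : ℝ) ^ c * U ^ 2)) := by field_simp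
            _ ≤ _ := by gcongr
        linarith
      · unfold ContentOblivious.phases
        rw [if_neg (not_le.2 hU)]
        exact Nat.succ_pos _
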